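/- Let $k,n$ be natural numbers, let $A_1,\dots,A_k\in\mathbb R^{n\times n}$, and for $i=1,\dots,k$ let $B_i$ be the $2n\times 2n$ matrix \[ B_i=\begin{pmatrix}0_{n\times n} & A_i^T\\ -A_i & -I_{n\times n}\end{pmatrix}. \] Then the following are equivalent: (i) there exist a norm $\|\cdot\|$ on $\mathbb R^{2n}$ and a real number $a>0$ such that the induced operator norm $\|M\|=\sup\{\|Mx\| : x\in\mathbb R^{2n},\ \|x\|=1\}$ satisfies \[ \|e^{B_i t}\|\le e^{-at}\qquad\text{for all } t\ge 0 \text{ and all } i=1,\dots,k; \] (ii) every matrix in the convex hull $\{\sum_{i=1}^k\alpha_iA_i : \alpha_i\ge 0,\ \sum_{i=1}^k\alpha_i=1\}$ of $A_1,\dots,A_k$ is nonsingular. -/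

import Mathlib

open scoped Matrix

/-- The block matrix `[[0, Aᵀ], [-A, -I]]`, of size `2n × 2n`; the index type `Fin n ⊕ Fin n`
lists the first `n` and then the last `n` coordinates of `ℝ²ⁿ`. -/
def blockMatrix {n : ℕ} (A : Matrix (Fin n) (Fin n) ℝ) :
    Matrix (Fin n ⊕ Fin n) (Fin n ⊕ Fin n) ℝ :=
  Matrix.fromBlocks 0 Aᵀ (-A) (-1)

/-- A seminorm is a norm if it vanishes only at `0`. -/
def IsNorm {ι : Type} (N : Seminorm ℝ (ι → ℝ)) : Prop :=
  ∀ x, N x = 0 → x = 0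

/-- The operator norm of a square matrix induced by the norm `N` on vectors:
the supremum of `N (M x)` over all `x` with `N x = 1`. -/
noncomputable def inducedNorm {ι : Type} [Fintype ι] (N : Seminorm ℝ (ι → ℝ))
    (M : Matrix ι ι ℝ) : ℝ :=
  sSup {r : ℝ | ∃ x : ι → ℝ, N x = 1 ∧ r = N (M *ᵥ x)}

open Filter Topology Set

/-! (i) ⇒ (ii): if `M` in the hull kills `u ≠ 0`, take a functional `g` supporting the norm ball at
`x = (u, 0)`. Decay forces `g (B_i x) ≤ -a N x` for all `i`. As `B_i x = (0, -A_i u)` is linear in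
`A_i`, the bound passes to `M`, where the left side is `0`.

(ii) ⇒ (i): with `x = (p, q)`, the derivative of a power `V` of `|x|²` along each `B_i` is
nonpositive, and on `x ≠ 0` it vanishes only if `q = 0`. There, since `0` is not in the hull of the
`A_i p`, some `f` is positive on all of them. A correction `H = ∑ w_f(p) f(q)` then has negative
derivative where `q = 0`, so `V + ε H` is a common homogeneous Lyapunov function for small `ε`
(`exists_lyapunov`). The gauge of the absolutely convex hull of a sublevel set is the norm
(`exists_isNorm_of_lyapunov`). -/

theorem eventually_add_mul_neg {X : Type*} [TopologicalSpace X] {K : Set X} (hK : IsCompact K)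
    {f h : X → ℝ} (hf : Continuous f) (hh : Continuous h) (hf0 : ∀ x ∈ K, f x ≤ 0)
    (hh0 : ∀ x ∈ K, f x = 0 → h x < 0) :
    ∀ᶠ ε in 𝓝[>] (0 : ℝ), ∀ x ∈ K, f x + ε * h x < 0 := by
  -- Where `h < 0` every `ε > 0` works; on the remaining compact set `f` is bounded away from `0`.
  have hK' : IsCompact (K ∩ {x | 0 ≤ h x}) :=
    hK.inter_right (isClosed_le continuous_const hh)
  obtain ⟨c, hc, hcf⟩ := hK'.exists_forall_le' (f := fun x => -f x) hf.neg.continuousOn (a := 0) (by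
    rintro x ⟨hxK, hx⟩
    have h1 := hf0 x hxK
    rcases h1.lt_or_eq with h2 | h2
    · simpa using h2
    · exact absurd (hh0 x hxK h2) (not_lt.2 hx))
  obtain ⟨M, hM⟩ := hK'.bddAbove_image hh.continuousOn
  have h1 : Tendsto (fun ε : ℝ => ε * M) (𝓝[>] 0) (𝓝 0) := by
    have : Tendsto (fun ε : ℝ => ε * M) (𝓝 0) (𝓝 (0 * M)) := by
      exact (continuous_id.mul continuous_const).tendsto 0
    rw [zero_mul] at this
    exact this.mono_left nhdsWithin_le_nhds
  filter_upwards [h1.eventually (gt_mem_nhds hc), self_mem_nhdsWithin] with ε h2 h3 x hx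
  have h3' : 0 < ε := h3
  by_cases hx0 : 0 ≤ h x
  · have h4 := hcf x ⟨hx, hx0⟩
    have h5 : h x ≤ M := hM ⟨x, ⟨hx, hx0⟩, rfl⟩
    have := mul_le_mul_of_nonneg_left h5 h3'.le
    linarith
  · have := mul_neg_of_pos_of_neg h3' (not_le.1 hx0)
    linarith [hf0 x hx]

/-! ### From a common Lyapunov function to a common norm -/

open scoped Matrix.Norms.Operator in
theorem hasDerivAt_exp_smul_mulVec {ι : Type*} [Fintype ι] [DecidableEq ι] (B : Matrix ι ι ℝ)
    (x : ι → ℝ) (t : ℝ) :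
    HasDerivAt (fun s : ℝ => NormedSpace.exp (s • B) *ᵥ x)
      (B *ᵥ (NormedSpace.exp (t • B) *ᵥ x)) t := by
  have h := hasDerivAt_exp_smul_const' (𝕂 := ℝ) B t
  let L : Matrix ι ι ℝ →L[ℝ] (ι → ℝ) :=
    LinearMap.toContinuousLinearMap ((Matrix.mulVecBilin ℝ ℝ).flip x)
  have h2 := L.hasFDerivAt.comp_hasDerivAt t h
  rw [Matrix.mulVec_mulVec]
  exact h2

theorem fderiv_smul_of_homogeneous {E : Type*} [NormedAddCommGroup E] [NormedSpace ℝ E]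
    {W : E → ℝ} {m : ℕ} (hW : Differentiable ℝ W)
    (hom : ∀ c : ℝ, 0 < c → ∀ x, W (c • x) = c ^ m * W x) {c : ℝ} (hc : 0 < c) (x y : E) :
    fderiv ℝ W (c • x) (c • y) = c ^ m * fderiv ℝ W x y := by
  have h1 : HasFDerivAt (fun z => W (c • z)) ((fderiv ℝ W (c • x)).comp
      (c • ContinuousLinearMap.id ℝ E)) x :=
    (hW (c • x)).hasFDerivAt.comp x ((hasFDerivAt_id x).const_smul c)
  have h2 : HasFDerivAt (fun z => W (c • z)) (c ^ m • fderiv ℝ W x) x := by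
    have : (fun z => W (c • z)) = fun z => c ^ m * W z := funext fun z => hom c hc z
    rw [this]
    exact (hW x).hasFDerivAt.const_mul _
  simpa using congrArg (fun L : E →L[ℝ] ℝ => L y) (h1.unique h2)

theorem le_exp_mul_of_fderiv_le {ι : Type*} [Fintype ι] [DecidableEq ι] {B : Matrix ι ι ℝ}
    {W : (ι → ℝ) → ℝ} (hW : Differentiable ℝ W) {c : ℝ}
    (h : ∀ x, fderiv ℝ W x (B *ᵥ x) ≤ -c * W x) (x : ι → ℝ) {t : ℝ} (ht : 0 ≤ t) :
    Real.exp (c * t) * W (NormedSpace.exp (t • B) *ᵥ x) ≤ W x := by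
  have hd : ∀ s : ℝ, HasDerivAt
      (fun s : ℝ => Real.exp (c * s) * W (NormedSpace.exp (s • B) *ᵥ x))
      (Real.exp (c * s) * (c * W (NormedSpace.exp (s • B) *ᵥ x) +
        fderiv ℝ W (NormedSpace.exp (s • B) *ᵥ x)
          (B *ᵥ (NormedSpace.exp (s • B) *ᵥ x)))) s := by
    intro s
    have h1 : HasDerivAt (fun s : ℝ => Real.exp (c * s)) (Real.exp (c * s) * c) s := by
      simpa using ((hasDerivAt_id s).const_mul c).exp
    have h2 := (hW (NormedSpace.exp (s • B) *ᵥ x)).hasFDerivAt.comp_hasDerivAt s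
      (hasDerivAt_exp_smul_mulVec B x s)
    exact (h1.mul h2).congr_deriv (by simp only [Function.comp]; ring)
  have hanti := antitone_of_deriv_nonpos (fun s => (hd s).differentiableAt) (fun s => by
    rw [(hd s).deriv]
    refine mul_nonpos_of_nonneg_of_nonpos (Real.exp_pos _).le ?_
    linarith [h (NormedSpace.exp (s • B) *ᵥ x)])
  simpa using hanti ht

/-- `S` need not be convex or symmetric: a linear map preserving `S` also preserves its absolutely
convex hull, whose gauge is the norm. -/
theorem exists_isNorm_of_image_subset {ι : Type} [Fintype ι]
    {S : Set (ι → ℝ)} (hS0 : S ∈ 𝓝 0) (hSb : Bornology.IsBounded S) :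
    ∃ N : Seminorm ℝ (ι → ℝ), IsNorm N ∧
      ∀ T : (ι → ℝ) →ₗ[ℝ] (ι → ℝ), (∀ x ∈ S, T x ∈ S) → ∀ x, N (T x) ≤ N x := by
  let C := absConvexHull ℝ S
  have hC0 : C ∈ 𝓝 0 := mem_of_superset hS0 subset_absConvexHull
  have hCa : Absorbent ℝ C := absorbent_nhds_zero hC0
  have hCb : Bornology.IsBounded C := by
    obtain ⟨r, hr⟩ := hSb.subset_ball 0
    exact Metric.isBounded_ball.subset
      (absConvexHull_min hr ⟨balanced_ball_zero, convex_ball _ _⟩)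
  refine ⟨gaugeSeminorm balanced_absConvexHull convex_absConvexHull hCa, ?_, ?_⟩
  · intro x hx
    exact (gauge_eq_zero hCa (NormedSpace.isVonNBounded_of_isBounded ℝ hCb)).1 hx
  · intro T hT x
    have hTC : C ⊆ T ⁻¹' C := absConvexHull_min
      (fun x hx => subset_absConvexHull (hT x hx))
      ⟨fun a ha => by
        rintro _ ⟨y, hy, rfl⟩
        simp only [mem_preimage, map_smul]
        exact balanced_absConvexHull a ha ⟨T y, hy, rfl⟩,
       convex_absConvexHull.linear_preimage T⟩
    change gauge C (T x) ≤ gauge C x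
    refine le_of_forall_gt_imp_ge_of_dense fun r hr => ?_
    obtain ⟨b, hb, hbr, y, hy, rfl⟩ := exists_lt_of_gauge_lt hCa hr
    refine (gauge_le_of_mem hb.le ⟨T y, (hTC hy : T y ∈ C), ?_⟩).trans hbr.le
    simp

theorem exists_isNorm_of_lyapunov {ι κ : Type} [Fintype ι] [DecidableEq ι] [Finite κ]
    {B : κ → Matrix ι ι ℝ} {W : (ι → ℝ) → ℝ} {m : ℕ} (hm : m ≠ 0) (hW : ContDiff ℝ 1 W)
    (hom : ∀ c : ℝ, 0 < c → ∀ x, W (c • x) = c ^ m * W x)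
    (pos : ∀ x, ‖x‖ = 1 → 0 < W x)
    (neg : ∀ i x, ‖x‖ = 1 → fderiv ℝ W x (B i *ᵥ x) < 0) :
    ∃ (N : Seminorm ℝ (ι → ℝ)) (a : ℝ), IsNorm N ∧ 0 < a ∧
      ∀ t : ℝ, 0 ≤ t → ∀ i x,
        N (NormedSpace.exp (t • B i) *ᵥ x) ≤ Real.exp (-a * t) * N x := by
  have hWd : Differentiable ℝ W := hW.differentiable one_ne_zero
  have hW0 : W 0 = 0 := by
    have h1 := hom 2 two_pos 0
    have h2 : (1 : ℝ) < 2 ^ m := one_lt_pow₀ one_lt_two hm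
    rw [smul_zero] at h1
    have h3 : ((2 : ℝ) ^ m - 1) * W 0 = 0 := by linarith
    rcases mul_eq_zero.1 h3 with h | h
    · linarith
    · exact h
  have hK : IsCompact (Metric.sphere (0 : ι → ℝ) 1) := isCompact_sphere 0 1
  have hcont : ∀ i, Continuous fun x => fderiv ℝ W x (B i *ᵥ x) := fun i =>
    (hW.continuous_fderiv one_ne_zero).clm_apply (Continuous.matrix_mulVec continuous_const continuous_id)
  -- Compactness of the sphere and finiteness of `κ` give a uniform decay rate; homogeneity then
  -- spreads it to all `x`.
  obtain ⟨c, hc, hc0⟩ : ∃ c, (∀ i, ∀ x ∈ Metric.sphere (0 : ι → ℝ) 1,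
      fderiv ℝ W x (B i *ᵥ x) + c * W x < 0) ∧ 0 < c := by
    refine ((eventually_all.2 fun i => eventually_add_mul_neg hK (hcont i) hW.continuous ?_ ?_).and
      self_mem_nhdsWithin).exists
    · intro x hx
      exact (neg i x (by simpa using hx)).le
    · intro x hx h0
      exact absurd h0 (neg i x (by simpa using hx)).ne
  have hle : ∀ i x, fderiv ℝ W x (B i *ᵥ x) ≤ -c * W x := by
    intro i x
    rcases eq_or_ne x 0 with rfl | hx
    · simp [hW0]
    have hx' : 0 < ‖x‖ := norm_pos_iff.2 hx
    have h1 := (hc i (‖x‖⁻¹ • x) (by simp [norm_smul, hx'.ne'])).le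
    rw [Matrix.mulVec_smul, fderiv_smul_of_homogeneous hWd hom (inv_pos.2 hx'),
      hom _ (inv_pos.2 hx')] at h1
    have h2 : 0 < (‖x‖⁻¹) ^ m := by positivity
    have h3 : (‖x‖⁻¹) ^ m * (fderiv ℝ W x (B i *ᵥ x) + c * W x) ≤ 0 := by linarith
    have h4 := nonpos_of_mul_nonpos_right h3 h2
    linarith
  obtain ⟨w, hw, hwW⟩ := hK.exists_forall_le' hW.continuous.continuousOn (a := 0)
    (fun x hx => pos x (by simpa using hx))
  have hSb : Bornology.IsBounded {x | W x ≤ 1} := by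
    refine (isBounded_iff_forall_norm_le).2 ⟨max 1 w⁻¹, fun x hx => ?_⟩
    rcases le_total ‖x‖ 1 with h1 | h1
    · exact h1.trans (le_max_left _ _)
    refine le_trans ?_ (le_max_right _ _)
    have hx' : 0 < ‖x‖ := one_pos.trans_le h1
    have h2 := hwW (‖x‖⁻¹ • x) (by simp [norm_smul, hx'.ne'])
    rw [hom _ (inv_pos.2 hx'), inv_pow, inv_mul_eq_div, le_div_iff₀ (by positivity)] at h2
    rw [← one_div, le_div_iff₀ hw]
    calc ‖x‖ * w ≤ ‖x‖ ^ m * w := by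
          gcongr
          exact le_self_pow₀ h1 hm
      _ ≤ W x := by linarith
      _ ≤ 1 := hx
  have hS0 : {x | W x ≤ 1} ∈ 𝓝 (0 : ι → ℝ) := by
    have h1 : W 0 < 1 := by rw [hW0]; exact one_pos
    have := (hW.continuous.tendsto 0).eventually (gt_mem_nhds h1)
    exact this.mono fun x hx => le_of_lt hx
  obtain ⟨N, hN, hNT⟩ := exists_isNorm_of_image_subset hS0 hSb
  -- Scaling a vector by `e^(ct/m)` multiplies `W` by `e^(ct)`, exactly offsetting the decay of `W`.
  refine ⟨N, c / m, hN, by positivity, fun t ht i x => ?_⟩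
  have h := hNT (Real.exp (c / m * t) • Matrix.toLin' (NormedSpace.exp (t • B i))) (by
    intro y hy
    simp only [LinearMap.smul_apply, Matrix.toLin'_apply, mem_ofPred_eq] at hy ⊢
    rw [hom _ (Real.exp_pos _), ← Real.exp_nat_mul]
    have hm' : (m : ℝ) ≠ 0 := by exact_mod_cast hm
    have : (m : ℝ) * (c / m * t) = c * t := by field_simp
    rw [this]
    exact (le_exp_mul_of_fderiv_le hWd (hle i) y ht).trans hy) x
  simp only [LinearMap.smul_apply, Matrix.toLin'_apply, map_smul_eq_mul, Real.norm_eq_abs,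
    Real.abs_exp] at h
  rw [neg_mul, Real.exp_neg, inv_mul_eq_div, le_div_iff₀ (Real.exp_pos _)]
  linarith

/-! ### Construction of the Lyapunov function -/

theorem contDiff_max_zero_sq : ContDiff ℝ 1 fun t : ℝ => max 0 t ^ 2 := by
  have hd : ∀ t : ℝ, HasDerivAt (fun t : ℝ => max 0 t ^ 2) (2 * max 0 t) t := by
    intro t
    rcases lt_trichotomy t 0 with ht | rfl | ht
    · rw [max_eq_left ht.le, mul_zero]
      refine (hasDerivAt_const t (0 : ℝ)).congr_of_eventuallyEq ?_
      filter_upwards [gt_mem_nhds ht] with s hs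
      simp [max_eq_left (le_of_lt hs)]
    · rw [max_self, mul_zero, hasDerivAt_iff_isLittleO]
      have h : (fun s : ℝ => s ^ 2) =o[𝓝 0] fun s : ℝ => s := by
        simpa using Asymptotics.isLittleO_pow_pow (𝕜 := ℝ) (m := 1) (n := 2) one_lt_two
      refine (Asymptotics.IsBigO.of_bound 1 (Eventually.of_forall fun s => ?_)).trans_isLittleO
        (by simpa using h)
      rcases le_total 0 s with hs | hs <;> simp [hs, sq_nonneg]
    · rw [max_eq_right ht.le]
      have h : HasDerivAt (fun s : ℝ => s ^ 2) (2 * t) t := by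
        simpa using hasDerivAt_pow 2 t
      refine h.congr_of_eventuallyEq ?_
      filter_upwards [lt_mem_nhds ht] with s hs
      simp [max_eq_right (le_of_lt hs)]
  rw [contDiff_one_iff_deriv]
  refine ⟨fun t => (hd t).differentiableAt, ?_⟩
  rw [funext fun t => (hd t).deriv]
  fun_prop

/-- Finitely many functionals suffice to make, for each unit vector `p`, one of them positive at
all the `A i *ᵥ p`. -/
theorem exists_finset_dual_pos {n k : ℕ} {A : Fin k → Matrix (Fin n) (Fin n) ℝ}
    (hA : ∀ M ∈ convexHull ℝ (range A), M.det ≠ 0) :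
    ∃ F : Finset ((Fin n → ℝ) →L[ℝ] ℝ), ∀ p : Fin n → ℝ, ‖p‖ = 1 →
      ∃ f ∈ F, ∀ i, 0 < f (A i *ᵥ p) := by
  have hsep : ∀ p : Fin n → ℝ, p ≠ 0 → ∃ f : (Fin n → ℝ) →L[ℝ] ℝ, ∀ i, 0 < f (A i *ᵥ p) := by
    intro p hp
    let L : Matrix (Fin n) (Fin n) ℝ →ₗ[ℝ] (Fin n → ℝ) := (Matrix.mulVecBilin ℝ ℝ).flip p
    -- The hull of the `A i *ᵥ p` consists of the `M *ᵥ p` with `M` in the hull, all nonzero, so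
    -- Hahn–Banach separates it from `0`.
    have h0 : (0 : Fin n → ℝ) ∉ convexHull ℝ (L '' range A) := by
      rw [← LinearMap.image_convexHull]
      rintro ⟨M, hM, hMp⟩
      exact hA M hM (Matrix.exists_mulVec_eq_zero_iff.1 ⟨p, hp, hMp⟩)
    obtain ⟨f, u, hu, hf⟩ := geometric_hahn_banach_point_closed (convex_convexHull ℝ _)
      (((finite_range A).image L).isClosed_convexHull ℝ) h0
    refine ⟨f, fun i => ?_⟩
    rw [map_zero] at hu
    exact hu.trans (hf _ (subset_convexHull ℝ _ ⟨A i, ⟨i, rfl⟩, rfl⟩))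
  obtain ⟨F, hF⟩ := (isCompact_sphere (0 : Fin n → ℝ) 1).elim_finite_subcover
    (fun f : (Fin n → ℝ) →L[ℝ] ℝ => {p | ∀ i, 0 < f (A i *ᵥ p)})
    (fun f => by
      simp only [ofPred_forall]
      exact isOpen_iInter_of_finite fun i => isOpen_lt continuous_const
        (f.continuous.comp (Continuous.matrix_mulVec continuous_const continuous_id)))
    (fun p hp => by
      obtain ⟨f, hf⟩ := hsep p (by rintro rfl; simp at hp)
      exact mem_iUnion.2 ⟨f, hf⟩)
  refine ⟨F, fun p hp => ?_⟩
  simpa using hF (show p ∈ Metric.sphere (0 : Fin n → ℝ) 1 by simpa using hp)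

/-- A continuously differentiable weight, homogeneous of degree `2 * k + 1`, that is positive
where `f` is positive at all `A i *ᵥ p` and zero elsewhere (when `k ≠ 0`). -/
noncomputable def coneWeight {n k : ℕ} (A : Fin k → Matrix (Fin n) (Fin n) ℝ)
    (f : (Fin n → ℝ) →L[ℝ] ℝ) (p : Fin n → ℝ) : ℝ :=
  (∏ i, max 0 (f (A i *ᵥ p)) ^ 2) * ∑ i, f (A i *ᵥ p)

section coneWeight

variable {n k : ℕ} {A : Fin k → Matrix (Fin n) (Fin n) ℝ} {f : (Fin n → ℝ) →L[ℝ] ℝ}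
  {p : Fin n → ℝ}

theorem contDiff_coneWeight : ContDiff ℝ 1 (coneWeight A f) := by
  have h : ∀ i, ContDiff ℝ 1 fun p : Fin n → ℝ => f (A i *ᵥ p) := fun i =>
    (f.comp (LinearMap.toContinuousLinearMap (Matrix.mulVecLin (A i)))).contDiff
  exact (contDiff_prod fun i _ => contDiff_max_zero_sq.comp (h i)).mul
    (ContDiff.sum fun i _ => h i)

theorem coneWeight_smul {c : ℝ} (hc : 0 < c) :
    coneWeight A f (c • p) = c ^ (2 * k + 1) * coneWeight A f p := by
  have h : ∀ i, max 0 (f (A i *ᵥ (c • p))) ^ 2 = c ^ 2 * max 0 (f (A i *ᵥ p)) ^ 2 := by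
    intro i
    rw [Matrix.mulVec_smul, map_smul, smul_eq_mul, ← mul_pow, mul_max_of_nonneg _ _ hc.le, mul_zero]
  simp only [coneWeight, h, Finset.prod_mul_distrib]
  simp only [Matrix.mulVec_smul, map_smul, smul_eq_mul, ← Finset.mul_sum, Finset.prod_const,
    Finset.card_univ, Fintype.card_fin]
  ring

theorem coneWeight_mul_nonneg (i : Fin k) : 0 ≤ coneWeight A f p * f (A i *ᵥ p) := by
  by_cases h : ∀ j, 0 < f (A j *ᵥ p)
  · have h1 : 0 ≤ ∑ j, f (A j *ᵥ p) := Finset.sum_nonneg fun j _ => (h j).le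
    have h2 := (h i).le
    unfold coneWeight
    positivity
  · push Not at h
    obtain ⟨j, hj⟩ := h
    have : ∏ i, max 0 (f (A i *ᵥ p)) ^ 2 = 0 :=
      Finset.prod_eq_zero (Finset.mem_univ j) (by simp [hj])
    simp [coneWeight, this]

theorem coneWeight_mul_pos (h : ∀ j, 0 < f (A j *ᵥ p)) (i : Fin k) :
    0 < coneWeight A f p * f (A i *ᵥ p) := by
  have h1 : 0 < ∑ j, f (A j *ᵥ p) := Finset.sum_pos (fun j _ => h j) ⟨i, Finset.mem_univ i⟩
  have h2 : 0 < ∏ i, max 0 (f (A i *ᵥ p)) ^ 2 :=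
    Finset.prod_pos fun j _ => by have := h j; positivity
  exact mul_pos (mul_pos h2 h1) (h i)

end coneWeight

theorem blockMatrix_mulVec_inl {n : ℕ} (A : Matrix (Fin n) (Fin n) ℝ) (x : Fin n ⊕ Fin n → ℝ) :
    (fun j => (blockMatrix A *ᵥ x) (Sum.inl j)) = Aᵀ *ᵥ fun j => x (Sum.inr j) := by
  rw [blockMatrix, Matrix.fromBlocks_mulVec]
  funext j
  simp [Function.comp_def]

theorem blockMatrix_mulVec_inr {n : ℕ} (A : Matrix (Fin n) (Fin n) ℝ) (x : Fin n ⊕ Fin n → ℝ) :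
    (fun j => (blockMatrix A *ᵥ x) (Sum.inr j)) =
      -(A *ᵥ fun j => x (Sum.inl j)) - fun j => x (Sum.inr j) := by
  rw [blockMatrix, Matrix.fromBlocks_mulVec]
  funext j
  simp [Function.comp_def, Matrix.neg_mulVec, sub_eq_add_neg]

/-- The off-diagonal blocks are skew and cancel; only the damping block `-1` remains. -/
theorem dotProduct_blockMatrix_mulVec {n : ℕ} (A : Matrix (Fin n) (Fin n) ℝ)
    (x : Fin n ⊕ Fin n → ℝ) :
    x ⬝ᵥ (blockMatrix A *ᵥ x) = -((fun j => x (Sum.inr j)) ⬝ᵥ fun j => x (Sum.inr j)) := by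
  have h : x ⬝ᵥ (blockMatrix A *ᵥ x) =
      (fun j => x (Sum.inl j)) ⬝ᵥ (fun j => (blockMatrix A *ᵥ x) (Sum.inl j)) +
      (fun j => x (Sum.inr j)) ⬝ᵥ (fun j => (blockMatrix A *ᵥ x) (Sum.inr j)) := by
    simp [dotProduct, Fintype.sum_sum_type]
  rw [h, blockMatrix_mulVec_inl, blockMatrix_mulVec_inr, Matrix.mulVec_transpose, dotProduct_sub,
    dotProduct_neg, Matrix.dotProduct_mulVec, dotProduct_comm _ ((fun j => x (Sum.inr j)) ᵥ* A)]
  ring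

theorem hasFDerivAt_dotProduct_self_pow {ι : Type*} [Fintype ι] (m : ℕ) (x : ι → ℝ) :
    ∃ L : (ι → ℝ) →L[ℝ] ℝ, HasFDerivAt (fun x : ι → ℝ => (x ⬝ᵥ x) ^ (m + 1)) L x ∧
      ∀ y, L y = (m + 1) * (x ⬝ᵥ x) ^ m * (2 * (x ⬝ᵥ y)) := by
  have h1 : HasFDerivAt (fun x : ι → ℝ => x ⬝ᵥ x)
      (∑ i, (x i • ContinuousLinearMap.proj (R := ℝ) (φ := fun _ : ι => ℝ) i +
        x i • ContinuousLinearMap.proj (R := ℝ) (φ := fun _ : ι => ℝ) i)) x :=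
    HasFDerivAt.fun_sum fun i _ => (hasFDerivAt_apply i x).mul (hasFDerivAt_apply i x)
  refine ⟨_, h1.pow (m + 1), fun y => ?_⟩
  simp [dotProduct, ← two_mul, Finset.mul_sum]

theorem exists_lyapunov {n k : ℕ} {A : Fin k → Matrix (Fin n) (Fin n) ℝ}
    (hA : ∀ M ∈ convexHull ℝ (range A), M.det ≠ 0) :
    ∃ W : (Fin n ⊕ Fin n → ℝ) → ℝ, ContDiff ℝ 1 W ∧
      (∀ c : ℝ, 0 < c → ∀ x, W (c • x) = c ^ (2 * (k + 1)) * W x) ∧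
      (∀ x, ‖x‖ = 1 → 0 < W x) ∧
      ∀ i x, ‖x‖ = 1 → fderiv ℝ W x (blockMatrix (A i) *ᵥ x) < 0 := by
  obtain ⟨F, hF⟩ := exists_finset_dual_pos hA
  let P : (Fin n ⊕ Fin n → ℝ) →L[ℝ] (Fin n → ℝ) :=
    ContinuousLinearMap.pi fun j => ContinuousLinearMap.proj (Sum.inl j)
  let Q : (Fin n ⊕ Fin n → ℝ) →L[ℝ] (Fin n → ℝ) :=
    ContinuousLinearMap.pi fun j => ContinuousLinearMap.proj (Sum.inr j)
  have hPQ : ∀ x, P x = 0 → Q x = 0 → x = 0 := by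
    intro x h1 h2
    funext j
    rcases j with j | j
    · exact congrFun h1 j
    · exact congrFun h2 j
  -- The exponent matches the degree `(2 * k + 1) + 1` of `H`, so that the sum is homogeneous.
  let V : (Fin n ⊕ Fin n → ℝ) → ℝ := fun x => (x ⬝ᵥ x) ^ (k + 1)
  let H : (Fin n ⊕ Fin n → ℝ) → ℝ := fun x => ∑ f ∈ F, coneWeight A f (P x) * f (Q x)
  have hV : ContDiff ℝ 1 V := by
    have : ContDiff ℝ 1 fun x : Fin n ⊕ Fin n → ℝ => x ⬝ᵥ x :=
      ContDiff.sum fun i _ => (contDiff_apply ℝ ℝ i).mul (contDiff_apply ℝ ℝ i)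
    exact this.pow _
  have hH : ContDiff ℝ 1 H := ContDiff.sum fun f _ =>
    (contDiff_coneWeight.comp P.contDiff).mul (f.comp Q).contDiff
  have hpos : ∀ x : Fin n ⊕ Fin n → ℝ, x ≠ 0 → 0 < x ⬝ᵥ x := fun x hx =>
    lt_of_le_of_ne (Finset.sum_nonneg fun i _ => mul_self_nonneg _)
      (fun h => hx (dotProduct_self_eq_zero.1 h.symm))
  have hVB : ∀ i x, fderiv ℝ V x (blockMatrix (A i) *ᵥ x) =
      -(2 * (k + 1) * (x ⬝ᵥ x) ^ k * (Q x ⬝ᵥ Q x)) := by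
    intro i x
    obtain ⟨L, hL, hLy⟩ := hasFDerivAt_dotProduct_self_pow k x
    rw [hL.fderiv, hLy, dotProduct_blockMatrix_mulVec]
    change _ * (2 * -(Q x ⬝ᵥ Q x)) = _
    ring
  -- At `Q x = 0` the derivatives of the weights drop out, each being multiplied by `f (Q x) = 0`.
  have hHB : ∀ i x, Q x = 0 → fderiv ℝ H x (blockMatrix (A i) *ᵥ x) =
      -∑ f ∈ F, coneWeight A f (P x) * f (A i *ᵥ P x) := by
    intro i x hx
    have hder : HasFDerivAt H _ x := HasFDerivAt.fun_sum fun f _ =>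
      HasFDerivAt.mul (((contDiff_coneWeight (A := A) (f := f)).comp P.contDiff).differentiable
        one_ne_zero x).hasFDerivAt (f.comp Q).hasFDerivAt
    have hQ : Q (blockMatrix (A i) *ᵥ x) = -(A i *ᵥ P x) := by
      have h : Q (blockMatrix (A i) *ᵥ x) = -(A i *ᵥ P x) - Q x :=
        blockMatrix_mulVec_inr (A i) x
      rw [h, hx, sub_zero]
    rw [hder.fderiv]
    simp [hx, hQ, Finset.sum_neg_distrib]
  have hne : ∀ x : Fin n ⊕ Fin n → ℝ, x ∈ Metric.sphere (0 : Fin n ⊕ Fin n → ℝ) 1 → x ≠ 0 := by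
    rintro x hx rfl
    simp at hx
  have hK : IsCompact (Metric.sphere (0 : Fin n ⊕ Fin n → ℝ) 1) := isCompact_sphere 0 1
  have hmv : ∀ i, Continuous fun x : Fin n ⊕ Fin n → ℝ => blockMatrix (A i) *ᵥ x := fun i =>
    Continuous.matrix_mulVec continuous_const continuous_id
  have hneg : ∀ᶠ ε in 𝓝[>] (0 : ℝ), ∀ i, ∀ x ∈ Metric.sphere (0 : Fin n ⊕ Fin n → ℝ) 1,
      fderiv ℝ V x (blockMatrix (A i) *ᵥ x) + ε * fderiv ℝ H x (blockMatrix (A i) *ᵥ x) < 0 := by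
    refine eventually_all.2 fun i => eventually_add_mul_neg hK
      ((hV.continuous_fderiv one_ne_zero).clm_apply (hmv i))
      ((hH.continuous_fderiv one_ne_zero).clm_apply (hmv i)) (fun x hx => ?_) (fun x hx h0 => ?_)
    · rw [hVB, neg_nonpos]
      have h1 := hpos x (hne x hx)
      have h2 : 0 ≤ Q x ⬝ᵥ Q x := Finset.sum_nonneg fun i _ => mul_self_nonneg _
      positivity
    · have h1 := hpos x (hne x hx)
      have hQ : Q x = 0 := by
        rw [hVB, neg_eq_zero, mul_eq_zero] at h0
        rcases h0 with h0 | h0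
        · exact absurd h0 (by positivity)
        · exact dotProduct_self_eq_zero.1 h0
      have hP : P x ≠ 0 := fun h => hne x hx (hPQ x h hQ)
      have hP' : 0 < ‖P x‖ := norm_pos_iff.2 hP
      obtain ⟨f, hf, hfA⟩ := hF (‖P x‖⁻¹ • P x) (by simp [norm_smul, hP'.ne'])
      rw [hHB i x hQ, neg_lt_zero]
      refine Finset.sum_pos' (fun f _ => coneWeight_mul_nonneg i) ⟨f, hf, coneWeight_mul_pos ?_ i⟩
      intro j
      have h2 := hfA j
      rw [Matrix.mulVec_smul, map_smul, smul_eq_mul] at h2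
      exact pos_of_mul_pos_right h2 (inv_pos.2 hP').le
  have hVpos : ∀ᶠ ε in 𝓝[>] (0 : ℝ), ∀ x ∈ Metric.sphere (0 : Fin n ⊕ Fin n → ℝ) 1,
      -V x + ε * -H x < 0 := by
    have h : ∀ x ∈ Metric.sphere (0 : Fin n ⊕ Fin n → ℝ) 1, -V x < 0 := fun x hx =>
      neg_lt_zero.2 (pow_pos (hpos x (hne x hx)) _)
    exact eventually_add_mul_neg hK hV.continuous.neg hH.continuous.neg (fun x hx => (h x hx).le)
      (fun x hx h0 => absurd h0 (h x hx).ne)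
  obtain ⟨ε, hε1, hε2⟩ := (hneg.and hVpos).exists
  refine ⟨fun x => V x + ε * H x, hV.add (contDiff_const.mul hH), fun c hc x => ?_,
    fun x hx => ?_, fun i x hx => ?_⟩
  · have h1 : V (c • x) = c ^ (2 * (k + 1)) * V x := by
      simp only [V, smul_dotProduct, dotProduct_smul, smul_eq_mul]
      ring
    have h2 : H (c • x) = c ^ (2 * (k + 1)) * H x := by
      simp only [H, map_smul, coneWeight_smul hc, smul_eq_mul, Finset.mul_sum]
      exact Finset.sum_congr rfl fun f _ => by ring
    simp only [h1, h2]
    ring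
  · have := hε2 x (by simpa using hx)
    linarith
  · have h := ((hV.differentiable one_ne_zero x).hasFDerivAt.add
      ((hH.differentiable one_ne_zero x).hasFDerivAt.const_mul ε)).fderiv
    have h' := hε1 i x (by simpa using hx)
    change fderiv ℝ (V + fun x => ε * H x) x _ < 0
    rw [h]
    simpa using h'

/-! ### Induced norms and supporting functionals -/

theorem Seminorm.continuous_pi_real {ι : Type} [Fintype ι] (N : Seminorm ℝ (ι → ℝ)) :
    Continuous N :=
  continuousOn_univ.1 (N.convexOn.continuousOn isOpen_univ)

theorem IsNorm.apply_mulVec_le {ι : Type} [Fintype ι] {N : Seminorm ℝ (ι → ℝ)} (hN : IsNorm N)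
    (M : Matrix ι ι ℝ) (x : ι → ℝ) : N (M *ᵥ x) ≤ inducedNorm N M * N x := by
  have hc := N.continuous_pi_real
  -- The real `sSup` is only meaningful for bounded sets; here the unit sphere of `N` is bounded
  -- because `N` is definite.
  have hbdd : BddAbove {r : ℝ | ∃ x : ι → ℝ, N x = 1 ∧ r = N (M *ᵥ x)} := by
    obtain ⟨a, ha, haN⟩ := (isCompact_sphere (0 : ι → ℝ) 1).exists_forall_le' hc.continuousOn
      (a := 0) (fun x hx => lt_of_le_of_ne (apply_nonneg N x) (fun h => by
        rw [hN x h.symm] at hx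
        simp at hx))
    obtain ⟨b, hb⟩ := (isCompact_closedBall (0 : ι → ℝ) a⁻¹).bddAbove_image
      (hc.comp (Continuous.matrix_mulVec (continuous_const (y := M)) continuous_id)).continuousOn
    refine ⟨b, ?_⟩
    rintro _ ⟨y, hy, rfl⟩
    refine hb ⟨y, ?_, rfl⟩
    rw [mem_closedBall_zero_iff]
    rcases eq_or_ne y 0 with rfl | hy0
    · simpa using ha.le
    have hy' : 0 < ‖y‖ := norm_pos_iff.2 hy0
    have h := haN (‖y‖⁻¹ • y) (by simp [norm_smul, hy'.ne'])
    rw [map_smul_eq_mul, hy, mul_one, norm_inv, norm_norm] at h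
    exact (le_inv_comm₀ ha hy').1 h
  rcases eq_or_ne (N x) 0 with h0 | h0
  · simp [hN x h0]
  have hx : 0 < N x := lt_of_le_of_ne (apply_nonneg N x) h0.symm
  have h := le_csSup hbdd ⟨(N x)⁻¹ • x, by
    rw [map_smul_eq_mul, norm_inv, Real.norm_of_nonneg hx.le, inv_mul_cancel₀ h0], rfl⟩
  rw [Matrix.mulVec_smul, map_smul_eq_mul, norm_inv, Real.norm_of_nonneg hx.le,
    inv_mul_eq_div, div_le_iff₀ hx] at h
  exact h

theorem Seminorm.exists_dual_vector_real {E : Type*} [AddCommGroup E] [Module ℝ E]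
    (N : Seminorm ℝ E) {x : E} (hx : x ≠ 0) :
    ∃ g : E →ₗ[ℝ] ℝ, g x = N x ∧ ∀ y, g y ≤ N y := by
  obtain ⟨g, hg, hgN⟩ := exists_extension_of_le_sublinear
    (LinearPMap.mkSpanSingleton x (N x) hx) N
    (fun c hc y => by rw [map_smul_eq_mul, Real.norm_of_nonneg hc.le])
    (fun y z => map_add_le_add N y z) (by
      rintro ⟨y, hy⟩
      obtain ⟨c, rfl⟩ := Submodule.mem_span_singleton.1 hy
      rw [LinearPMap.mkSpanSingleton'_apply, map_smul_eq_mul, smul_eq_mul]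
      exact mul_le_mul_of_nonneg_right (le_abs_self c) (apply_nonneg N x))
  refine ⟨g, ?_, hgN⟩
  rw [hg ⟨x, Submodule.mem_span_singleton_self x⟩]
  exact LinearPMap.mkSpanSingleton_apply ℝ ℝ hx (N x)

/-- `g (e^(tB) x) ≤ e^(-at) N x` for `t ≥ 0`, with equality at `t = 0`, so the right derivatives at
`0` compare. -/
theorem dual_mulVec_le_of_exp_le {ι : Type} [Fintype ι] [DecidableEq ι] {N : Seminorm ℝ (ι → ℝ)}
    {B : Matrix ι ι ℝ} {a : ℝ} {x : ι → ℝ} {g : (ι → ℝ) →ₗ[ℝ] ℝ} (hgx : g x = N x)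
    (hg : ∀ y, g y ≤ N y)
    (hB : ∀ t : ℝ, 0 ≤ t → N (NormedSpace.exp (t • B) *ᵥ x) ≤ Real.exp (-a * t) * N x) :
    g (B *ᵥ x) ≤ -a * N x := by
  have h1 : HasDerivAt (fun t : ℝ => g (NormedSpace.exp (t • B) *ᵥ x)) (g (B *ᵥ x)) 0 := by
    have := (LinearMap.toContinuousLinearMap g).hasFDerivAt.comp_hasDerivAt 0
      (hasDerivAt_exp_smul_mulVec B x 0)
    simpa [Function.comp_def] using this
  have h2 : HasDerivAt (fun t : ℝ => Real.exp (-a * t) * N x) (-a * N x) 0 := by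
    simpa using (((hasDerivAt_id (0 : ℝ)).const_mul (-a)).exp).mul_const (N x)
  have h3 := h1.sub h2
  have h4 := h3.hasDerivWithinAt (s := Ioi 0)
  rw [hasDerivWithinAt_iff_tendsto_slope' (by simp)] at h4
  have h5 : g (B *ᵥ x) - -a * N x ≤ 0 := by
    refine le_of_tendsto h4 ?_
    filter_upwards [self_mem_nhdsWithin] with t ht
    have ht' : 0 < t := ht
    rw [slope_def_field]
    refine div_nonpos_of_nonpos_of_nonneg ?_ (by linarith)
    simpa [hgx] using (hg _).trans (hB t ht'.le)
  linarith

theorem lemma4 (k n : ℕ) (A : Fin k → Matrix (Fin n) (Fin n) ℝ) :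
    (∃ (N : Seminorm ℝ (Fin n ⊕ Fin n → ℝ)) (a : ℝ), IsNorm N ∧ 0 < a ∧
      ∀ t : ℝ, 0 ≤ t → ∀ i : Fin k,
        inducedNorm N (NormedSpace.exp (t • blockMatrix (A i))) ≤ Real.exp (-a * t)) ↔
    ∀ M ∈ convexHull ℝ (Set.range A), M.det ≠ 0 := by
  constructor
  · rintro ⟨N, a, hN, ha, h⟩ M hM hdet
    obtain ⟨u, hu, hMu⟩ := Matrix.exists_mulVec_eq_zero_iff.2 hdet
    have hx : (Sum.elim u 0 : Fin n ⊕ Fin n → ℝ) ≠ 0 := fun h0 =>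
      hu (funext fun j => congrFun h0 (Sum.inl j))
    obtain ⟨g, hgx, hgN⟩ := N.exists_dual_vector_real hx
    have hpos : 0 < N (Sum.elim u 0) :=
      lt_of_le_of_ne (apply_nonneg N _) fun h0 => hx (hN _ h0.symm)
    have hlin : ∀ M : Matrix (Fin n) (Fin n) ℝ,
        blockMatrix M *ᵥ (Sum.elim u 0 : Fin n ⊕ Fin n → ℝ) =
          Sum.elim (0 : Fin n → ℝ) (-(M *ᵥ u)) := by
      intro M
      rw [blockMatrix, Matrix.fromBlocks_mulVec]
      simp [Matrix.neg_mulVec]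
    let L : Matrix (Fin n) (Fin n) ℝ →ₗ[ℝ] ℝ :=
      { toFun := fun M => g (Sum.elim (0 : Fin n → ℝ) (-(M *ᵥ u)))
        map_add' := fun M M' => by
          rw [← map_add, ← Sum.elim_add_add, Matrix.add_mulVec, neg_add, add_zero]
        map_smul' := fun c M => by
          rw [← map_smul, Matrix.smul_mulVec]
          congr 1
          funext j
          rcases j with j | j <;> simp }
    have hsub : range A ⊆ {M | L M ≤ -a * N (Sum.elim u 0)} := by
      rintro _ ⟨i, rfl⟩
      change g (Sum.elim (0 : Fin n → ℝ) (-(A i *ᵥ u))) ≤ _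
      rw [← hlin]
      exact dual_mulVec_le_of_exp_le hgx hgN fun t ht => (hN.apply_mulVec_le _ _).trans
        (mul_le_mul_of_nonneg_right (h t ht i) hpos.le)
    have hLM : L M ≤ -a * N (Sum.elim u 0) :=
      convexHull_min hsub (convex_halfSpace_le L.isLinear _) hM
    have hL0 : L M = 0 := by
      change g (Sum.elim (0 : Fin n → ℝ) (-(M *ᵥ u))) = 0
      rw [hMu, neg_zero, Sum.elim_zero_zero, map_zero]
    have := mul_pos ha hpos
    linarith
  · intro hA
    obtain ⟨W, hW, hom, hpos, hneg⟩ := exists_lyapunov hA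
    obtain ⟨N, a, hN, ha, h⟩ := exists_isNorm_of_lyapunov (by omega) hW hom hpos hneg
    -- Nonnegativity of the bound covers `n = 0`, where the set is empty and its `sSup` is `0`.
    refine ⟨N, a, hN, ha, fun t ht i => Real.sSup_le ?_ (Real.exp_pos _).le⟩
    rintro _ ⟨x, hx, rfl⟩
    simpa [hx] using h t ht i x
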